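/- Let $Q$ be the quiver $a \xrightarrow{\alpha} b \xrightarrow{\beta} c \xrightarrow{\gamma} d$, and let $R$ consist of the single relation $\alpha\beta\gamma = 0$ (composites are written in diagrammatic order). Let $\mathcal{C}(Q,R)$ be the $\mathbb{Z}$-linear category whose objects are the vertices of $Q$ and whose morphisms are the $\mathbb{Z}$-linear combinations of paths modulo the two-sided ideal generated by $R$, and let $\mathbf{A} = \mathcal{C}(Q,R)^{\oplus}$ be its additive closure (finite, possibly empty, tuples of objects; matrices of morphisms). Let $\mathrm{Adel}(\mathbf{A})$ be the Adelman category of $\mathbf{A}$. Its objects are the pairs of composable morphisms $(r \xrightarrow{\rho} x \xrightarrow{\kappa} s)$ of $\mathbf{A}$ (with no condition on the composite). A morphism $\{f\}$ from $(r \xrightarrow{\rho} x \xrightarrow{\kappa} s)$ to $(r' \xrightarrow{\rho'} x' \xrightarrow{\kappa'} s')$ is given by a morphism $f : x \to x'$ for which there exist $\omega : r \to r'$ and $\psi : s \to s'$ with $\omega\rho' = \rho f$ and $\kappa\psi = f\kappa'$; two such morphisms $\{f\}$, $\{f'\}$ are equal iff $f - f' = \sigma_1\rho' + \kappa\sigma_2$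 for some $\sigma_1 : x \to r'$ and $\sigma_2 : s \to x'$. Write $x$ also for the object $(0 \to x \to 0)$. Then the following hold in $\mathrm{Adel}(\mathbf{A})$. 1. The diagram $$\begin{array}{ccccc} (0 \to a \xrightarrow{\alpha\beta} c) & \xrightarrow{\{\alpha\}} & (0 \to b \xrightarrow{\beta} c) & \xrightarrow{\{\mathrm{id}_b\}} & (a \xrightarrow{\alpha} b \xrightarrow{\beta\gamma} d) \\ {\scriptstyle \{\mathrm{id}_a\}}\downarrow & & {\scriptstyle \{\mathrm{id}_b\}}\downarrow & & {\scriptstyle \{\mathrm{id}_b\}}\downarrow \\ a & \xrightarrow{\{\alpha\}} & b & \xrightarrow{\{\mathrm{id}_b\}} & (a \xrightarrow{\alpha} b \to 0) \\ {\scriptstyle \{\alpha\beta\}}\downarrow & & {\scriptstyle \{\beta\}}\downarrow & & {\scriptstyle \{\beta\gamma\}}\downarrow \\ (0 \to c \xrightarrow{\gamma} d) & \xrightarrow{\{\mathrm{id}_c\}} & c & \xrightarrow{\{\gamma\}} & d \\ {\scriptstyle \{\mathrm{id}_c\}}\downarrow & & {\scriptstyle \{\mathrm{id}_c\}}\downarrow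 & & {\scriptstyle \{\mathrm{id}_d\}}\downarrow \\ (a \xrightarrow{\alpha\beta} c \xrightarrow{\gamma} d) & \xrightarrow{\{\mathrm{id}_c\}} & (b \xrightarrow{\beta} c \to 0) & \xrightarrow{\{\gamma\}} & (b \xrightarrow{\beta\gamma} d \to 0) \end{array}$$ commutes. 2. Its two middle rows are exact when completed to $a \to b \to (a \xrightarrow{\alpha} b \to 0) \to 0$ and $0 \to (0 \to c \xrightarrow{\gamma} d) \to c \to d$. 3. Its three columns are exact when completed by $0 \to$ at the top and $\to 0$ at the bottom. 4. The snake sequence $$(0 \to a \xrightarrow{\alpha\beta} c) \xrightarrow{\{\alpha\}} (0 \to b \xrightarrow{\beta} c) \xrightarrow{\{\mathrm{id}_b\}} (a \xrightarrow{\alpha} b \xrightarrow{\beta\gamma} d) \xrightarrow{\{\beta\}} (a \xrightarrow{\alpha\beta} c \xrightarrow{\gamma} d) \xrightarrow{\{\mathrm{id}_c\}} (b \xrightarrow{\beta} c \to 0) \xrightarrow{\{\gamma\}} (b \xrightarrow{\beta\gamma} d \to 0)$$ is exact at its four inner objects. -/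

import Mathlib

open CategoryTheory CategoryTheory.Limits

noncomputable section

universe v u

/-! ## The `ℤ`-linear category of a quiver with relations, and additive closures -/

section LinearCategory

/-- The preadditive category whose morphisms are the `ℤ`-linear combinations of paths of `Q`. -/
abbrev PathLinear (Q : Type u) [Quiver.{v} Q] : Type u := Free ℤ (Paths Q)

/-- A path, in particular an arrow, of `Q` as a morphism of `PathLinear Q`. -/
abbrev PathLinear.arrow {Q : Type u} [Quiver.{v} Q] {x y : Q} (e : x ⟶ y) :
    (Free.embedding ℤ (Paths Q)).obj ((Paths.of Q).obj x) ⟶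
      (Free.embedding ℤ (Paths Q)).obj ((Paths.of Q).obj y) :=
  (Free.embedding ℤ (Paths Q)).map ((Paths.of Q).map e)

/-- A family of sets of morphisms of `C`. -/
abbrev MorphismSets (C : Type u) [Category.{v} C] : Type (max u v) :=
  ∀ x y : C, Set (x ⟶ y)

/-- The two-sided ideal of a preadditive category generated by a family `R` of morphisms. -/
inductive GeneratedIdeal {C : Type u} [Category.{v} C] [Preadditive C] (R : MorphismSets C) :
    ∀ {x y : C}, (x ⟶ y) → Prop
  | of {x y : C} {f : x ⟶ y} (h : f ∈ R x y) : GeneratedIdeal R f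
  | zero (x y : C) : GeneratedIdeal R (0 : x ⟶ y)
  | add {x y : C} {f g : x ⟶ y} (hf : GeneratedIdeal R f) (hg : GeneratedIdeal R g) :
      GeneratedIdeal R (f + g)
  | neg {x y : C} {f : x ⟶ y} (hf : GeneratedIdeal R f) : GeneratedIdeal R (-f)
  | comp_left {x y z : C} (f : x ⟶ y) {g : y ⟶ z} (hg : GeneratedIdeal R g) :
      GeneratedIdeal R (f ≫ g)
  | comp_right {x y z : C} {f : x ⟶ y} (g : y ⟶ z) (hf : GeneratedIdeal R f) :
      GeneratedIdeal R (f ≫ g)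

variable {Q : Type u} [Quiver.{v} Q] (R : MorphismSets (PathLinear Q))

/-- Two linear combinations of paths are identified if they differ by an element of the ideal
generated by the relations. -/
def relHomRel : HomRel (PathLinear Q) := fun _ _ f g => GeneratedIdeal R (f - g)

instance relHomRel_congruence : Congruence (relHomRel R) where
  equivalence :=
    { refl := fun f => by
        simpa [relHomRel] using GeneratedIdeal.zero (R := R) _ _
      symm := fun {f g} h => by
        simpa [relHomRel] using GeneratedIdeal.neg h
      trans := fun {f g h} h₁ h₂ => by
        simpa [relHomRel] using GeneratedIdeal.add h₁ h₂ }
  comp_left f _ _ h := by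
    simpa [relHomRel, Preadditive.comp_sub] using GeneratedIdeal.comp_left f h
  comp_right g h := by
    simpa [relHomRel, Preadditive.sub_comp] using GeneratedIdeal.comp_right g h

theorem relHomRel_add ⦃x y : PathLinear Q⦄ (f₁ f₂ g₁ g₂ : x ⟶ y)
    (h₁ : relHomRel R f₁ f₂) (h₂ : relHomRel R g₁ g₂) :
    relHomRel R (f₁ + g₁) (f₂ + g₂) := by
  have h := GeneratedIdeal.add h₁ h₂
  have e : f₁ - f₂ + (g₁ - g₂) = f₁ + g₁ - (f₂ + g₂) := by abel
  rw [e] at h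
  exact h

/-- The category `𝒞(Q, R)`: its objects are the vertices of `Q`, its morphisms are the
`ℤ`-linear combinations of paths of `Q` modulo the relations `R` (each element of `R` is set
to zero). -/
def QuiverCat : Type u := CategoryTheory.Quotient (relHomRel R)

instance QuiverCat.category : Category.{max u v} (QuiverCat R) :=
  inferInstanceAs (Category (CategoryTheory.Quotient (relHomRel R)))

instance QuiverCat.preadditive : Preadditive (QuiverCat R) :=
  CategoryTheory.Quotient.preadditive (relHomRel R) (relHomRel_add R)

/-- The quotient functor from linear combinations of paths to `𝒞(Q, R)`. -/
def QuiverCat.proj : PathLinear Q ⥤ QuiverCat R :=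
  CategoryTheory.Quotient.functor (relHomRel R)

/-- The additive closure `𝒞(Q, R)^⊕`: finite tuples of objects and matrices of morphisms. -/
abbrev QuiverAdd : Type (max u 1) := Mat_ (QuiverCat R)

/-- A vertex of `Q` as an object (a one-entry tuple) of `𝒞(Q, R)^⊕`. -/
def QuiverAdd.vertex (x : Q) : QuiverAdd R :=
  (Mat_.embedding (QuiverCat R)).obj
    ((QuiverCat.proj R).obj ((Free.embedding ℤ (Paths Q)).obj ((Paths.of Q).obj x)))

/-- An arrow of `Q` as a morphism of `𝒞(Q, R)^⊕`. -/
def QuiverAdd.arrow {x y : Q} (e : x ⟶ y) :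
    QuiverAdd.vertex R x ⟶ QuiverAdd.vertex R y :=
  (Mat_.embedding (QuiverCat R)).map ((QuiverCat.proj R).map (PathLinear.arrow e))

/-- The empty tuple is a zero object of `𝒞(Q, R)^⊕`. -/
instance QuiverAdd.hasZeroObject : HasZeroObject (QuiverAdd R) :=
  ⟨⟨⟨PEmpty, PEmpty.elim⟩,
    { unique_to := fun _ => ⟨⟨⟨0⟩, fun f => by ext i; exact i.elim⟩⟩
      unique_from := fun _ => ⟨⟨⟨0⟩, fun f => by ext _ i; exact i.elim⟩⟩ }⟩⟩

end LinearCategory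

/-! ## The Adelman category -/

section Adelman

/-- A composable pair `relObj --rel--> obj --corel--> corelObj` (its composite need not be
zero). -/
structure ComposablePair (A : Type u) [Category.{v} A] where
  {relObj : A}
  {obj : A}
  {corelObj : A}
  /-- the relation morphism -/
  rel : relObj ⟶ obj
  /-- the corelation morphism -/
  corel : obj ⟶ corelObj

namespace ComposablePair

variable {A : Type u} [Category.{v} A] [Preadditive A]

/-- The morphisms `f` between the middle objects for which there exist a relation witness `ω` and
a corelation witness `ψ`. -/
def morphismData (X Y : ComposablePair A) : AddSubgroup (X.obj ⟶ Y.obj) where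
  carrier := {f | (∃ ω : X.relObj ⟶ Y.relObj, ω ≫ Y.rel = X.rel ≫ f) ∧
    ∃ ψ : X.corelObj ⟶ Y.corelObj, X.corel ≫ ψ = f ≫ Y.corel}
  zero_mem' := ⟨⟨0, by simp⟩, ⟨0, by simp⟩⟩
  add_mem' := by
    rintro f g ⟨⟨ω, hω⟩, ⟨ψ, hψ⟩⟩ ⟨⟨ω', hω'⟩, ⟨ψ', hψ'⟩⟩
    exact ⟨⟨ω + ω', by simp [hω, hω']⟩, ⟨ψ + ψ', by simp [hψ, hψ']⟩⟩
  neg_mem' := by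
    rintro f ⟨⟨ω, hω⟩, ⟨ψ, hψ⟩⟩
    exact ⟨⟨-ω, by simp [hω]⟩, ⟨-ψ, by simp [hψ]⟩⟩

/-- Composable pairs and morphism data, before passing to the quotient. -/
instance category : Category.{v} (ComposablePair A) where
  Hom X Y := morphismData X Y
  id X := ⟨𝟙 X.obj, ⟨𝟙 _, by simp⟩, ⟨𝟙 _, by simp⟩⟩
  comp {X Y Z} f g := ⟨f.1 ≫ g.1, by
    obtain ⟨f, ⟨ω, hω⟩, ⟨ψ, hψ⟩⟩ := f
    obtain ⟨g, ⟨ω', hω'⟩, ⟨ψ', hψ'⟩⟩ := g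
    exact ⟨⟨ω ≫ ω', by rw [Category.assoc, hω', reassoc_of% hω]⟩,
      ⟨ψ ≫ ψ', by rw [reassoc_of% hψ, hψ', Category.assoc]⟩⟩⟩
  id_comp f := Subtype.ext (Category.id_comp f.1)
  comp_id f := Subtype.ext (Category.comp_id f.1)
  assoc f g h := Subtype.ext (Category.assoc f.1 g.1 h.1)

instance preadditive : Preadditive (ComposablePair A) where
  homGroup X Y := inferInstanceAs (AddCommGroup (morphismData X Y))
  add_comp _ _ _ f f' g := Subtype.ext (Preadditive.add_comp _ _ _ f.1 f'.1 g.1)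
  comp_add _ _ _ f g g' := Subtype.ext (Preadditive.comp_add _ _ _ f.1 g.1 g'.1)

/-- Two morphism data are equal in the Adelman category if there is a witness pair `σ₁`, `σ₂`
with `f - f' = σ₁ · ρ + γ · σ₂`. -/
def homotopic : HomRel (ComposablePair A) := fun X Y f f' =>
  ∃ (σ₁ : X.obj ⟶ Y.relObj) (σ₂ : X.corelObj ⟶ Y.obj),
    f.1 - f'.1 = σ₁ ≫ Y.rel + X.corel ≫ σ₂

instance homotopic_congruence : Congruence (homotopic (A := A)) where
  equivalence :=
    { refl := fun f => ⟨0, 0, by simp⟩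
      symm := by
        rintro f g ⟨σ₁, σ₂, h⟩
        refine ⟨-σ₁, -σ₂, ?_⟩
        rw [← neg_sub, h]
        simp [add_comm]
      trans := by
        rintro f g k ⟨σ₁, σ₂, h⟩ ⟨τ₁, τ₂, h'⟩
        refine ⟨σ₁ + τ₁, σ₂ + τ₂, ?_⟩
        rw [← sub_add_sub_cancel f.1 g.1 k.1, h, h', Preadditive.add_comp, Preadditive.comp_add]
        abel }
  comp_left {X Y Z} f {g g'} h := by
    obtain ⟨σ₁, σ₂, h⟩ := h
    obtain ⟨f, -, ψ, hψ⟩ := f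
    refine ⟨f ≫ σ₁, ψ ≫ σ₂, ?_⟩
    change f ≫ g.1 - f ≫ g'.1 = _
    rw [← Preadditive.comp_sub, h, Preadditive.comp_add, Category.assoc, reassoc_of% hψ]
  comp_right {X Y Z f f'} g h := by
    obtain ⟨σ₁, σ₂, h⟩ := h
    obtain ⟨g, ⟨ω, hω⟩, -⟩ := g
    refine ⟨σ₁ ≫ ω, σ₂ ≫ g, ?_⟩
    change f.1 ≫ g - f'.1 ≫ g = _
    rw [← Preadditive.sub_comp, h, Preadditive.add_comp, Category.assoc, Category.assoc,
      Category.assoc, hω]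

theorem homotopic_add ⦃X Y : ComposablePair A⦄ (f₁ f₂ g₁ g₂ : X ⟶ Y)
    (h₁ : homotopic f₁ f₂) (h₂ : homotopic g₁ g₂) : homotopic (f₁ + g₁) (f₂ + g₂) := by
  obtain ⟨σ₁, σ₂, h⟩ := h₁
  obtain ⟨τ₁, τ₂, h'⟩ := h₂
  refine ⟨σ₁ + τ₁, σ₂ + τ₂, ?_⟩
  change (f₁.1 + g₁.1) - (f₂.1 + g₂.1) = _
  rw [add_sub_add_comm, h, h', Preadditive.add_comp, Preadditive.comp_add]
  abel

end ComposablePair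

/-- The Adelman category of `A`. -/
def Adel (A : Type u) [Category.{v} A] [Preadditive A] : Type (max u v) :=
  CategoryTheory.Quotient (ComposablePair.homotopic (A := A))

namespace Adel

variable {A : Type u} [Category.{v} A] [Preadditive A]

instance category : Category.{v} (Adel A) :=
  inferInstanceAs (Category (CategoryTheory.Quotient (ComposablePair.homotopic (A := A))))

instance preadditive : Preadditive (Adel A) :=
  CategoryTheory.Quotient.preadditive ComposablePair.homotopic ComposablePair.homotopic_add

/-- The object `(r --ρ--> a --γ--> c)` of the Adelman category. -/
def of {r a c : A} (ρ : r ⟶ a) (γ : a ⟶ c) : Adel A :=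
  (CategoryTheory.Quotient.functor ComposablePair.homotopic).obj ⟨ρ, γ⟩

/-- The morphism `{ω, f, ψ}` with morphism datum `f` and witnesses `ω`, `ψ`. It depends only
on `f`. -/
def mor {r a c r' a' c' : A} {ρ : r ⟶ a} {γ : a ⟶ c} {ρ' : r' ⟶ a'} {γ' : a' ⟶ c'}
    (ω : r ⟶ r') (f : a ⟶ a') (ψ : c ⟶ c') (hω : ω ≫ ρ' = ρ ≫ f) (hψ : γ ≫ ψ = f ≫ γ') :
    of ρ γ ⟶ of ρ' γ' :=
  (CategoryTheory.Quotient.functor (ComposablePair.homotopic (A := A))).map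
    (X := ⟨ρ, γ⟩) (Y := ⟨ρ', γ'⟩) ⟨f, ⟨ω, hω⟩, ⟨ψ, hψ⟩⟩

variable [HasZeroObject A]

open scoped ZeroObject

/-- The object `(0 ⟶ a ⟶ 0)`. -/
def emb (a : A) : Adel A := of (0 : (0 : A) ⟶ a) (0 : a ⟶ (0 : A))

/-- The object `(0 ⟶ a --γ--> c)`. -/
def ker {a c : A} (γ : a ⟶ c) : Adel A := of (0 : (0 : A) ⟶ a) γ

/-- The object `(r --ρ--> a ⟶ 0)`. -/
def coker {r a : A} (ρ : r ⟶ a) : Adel A := of ρ (0 : a ⟶ (0 : A))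

/-- The zero object `(0 ⟶ 0 ⟶ 0)`. -/
def zero : Adel A := emb (0 : A)

theorem zero_isZero : IsZero (zero : Adel A) := by
  rw [IsZero.iff_id_eq_zero]
  change (CategoryTheory.Quotient.functor (ComposablePair.homotopic (A := A))).map _ =
    (CategoryTheory.Quotient.functor (ComposablePair.homotopic (A := A))).map 0
  congr 1
  exact Subtype.ext ((Limits.isZero_zero A).eq_of_src _ _)

end Adel

end Adelman

/-! ## The universal instance of the snake lemma -/

namespace UniversalSnake

/-- The vertices of the quiver `a --α--> b --β--> c --γ--> d`. -/
inductive Vertex : Type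
  | a | b | c | d

/-- The arrows of the quiver `a --α--> b --β--> c --γ--> d`. -/
inductive Arrow : Vertex → Vertex → Type
  | α : Arrow .a .b
  | β : Arrow .b .c
  | γ : Arrow .c .d

instance : Quiver.{0} Vertex where
  Hom := Arrow

def arrowα : Vertex.a ⟶ Vertex.b := Arrow.α
def arrowβ : Vertex.b ⟶ Vertex.c := Arrow.β
def arrowγ : Vertex.c ⟶ Vertex.d := Arrow.γ

/-- The single relation `α · β · γ = 0`. -/
inductive IsRelation : ∀ x y : PathLinear Vertex, (x ⟶ y) → Prop
  | αβγ : IsRelation _ _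
      (PathLinear.arrow arrowα ≫ PathLinear.arrow arrowβ ≫ PathLinear.arrow arrowγ)

def relations : MorphismSets (PathLinear Vertex) := fun x y => {f | IsRelation x y f}

/-- The additive category `𝒞(Q, R)^⊕` of the quiver above with the relation above. -/
abbrev BaseCat : Type 1 := QuiverAdd relations

abbrev a : BaseCat := QuiverAdd.vertex relations Vertex.a
abbrev b : BaseCat := QuiverAdd.vertex relations Vertex.b
abbrev c : BaseCat := QuiverAdd.vertex relations Vertex.c
abbrev d : BaseCat := QuiverAdd.vertex relations Vertex.d

abbrev α : a ⟶ b := QuiverAdd.arrow relations arrowα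
abbrev β : b ⟶ c := QuiverAdd.arrow relations arrowβ
abbrev γ : c ⟶ d := QuiverAdd.arrow relations arrowγ

theorem comp_eq_zero : α ≫ β ≫ γ = 0 := by
  have h : (QuiverCat.proj relations).map
      (PathLinear.arrow arrowα ≫ PathLinear.arrow arrowβ ≫ PathLinear.arrow arrowγ) =
      (QuiverCat.proj relations).map 0 :=
    CategoryTheory.Quotient.sound _ (by
      change GeneratedIdeal relations (_ - 0)
      rw [sub_zero]
      exact GeneratedIdeal.of IsRelation.αβγ)
  have e := congrArg (Mat_.embedding (QuiverCat relations)).map h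
  simp only [Functor.map_comp] at e
  exact e

/-- The Adelman category of `𝒞(Q, R)^⊕`. -/
abbrev AdelCat : Type 1 := Adel BaseCat

/-! The objects of the diagram other than the zero object and `(0 ⟶ x ⟶ 0)`. -/

/-- `(0 ⟶ a --αβ--> c)` -/
abbrev kerαβ : AdelCat := Adel.ker (α ≫ β)
/-- `(0 ⟶ b --β--> c)` -/
abbrev kerβ : AdelCat := Adel.ker β
/-- `(a --α--> b --βγ--> d)` -/
abbrev K : AdelCat := Adel.of α (β ≫ γ)
/-- `(a --α--> b ⟶ 0)` -/
abbrev cokerα : AdelCat := Adel.coker α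
/-- `(0 ⟶ c --γ--> d)` -/
abbrev kerγ : AdelCat := Adel.ker γ
/-- `(a --αβ--> c --γ--> d)` -/
abbrev C : AdelCat := Adel.of (α ≫ β) γ
/-- `(b --β--> c ⟶ 0)` -/
abbrev cokerβ : AdelCat := Adel.coker β
/-- `(b --βγ--> d ⟶ 0)` -/
abbrev cokerβγ : AdelCat := Adel.coker (β ≫ γ)

/-! The morphisms of the diagram between nonzero objects. -/

/-- `{α} : (0 ⟶ a --αβ--> c) ⟶ (0 ⟶ b --β--> c)` -/
def kerαβ_kerβ : kerαβ ⟶ kerβ := Adel.mor (𝟙 _) α (𝟙 c) (by simp) (by simp)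
/-- `{id_b} : (0 ⟶ b --β--> c) ⟶ (a --α--> b --βγ--> d)` -/
def kerβ_K : kerβ ⟶ K := Adel.mor 0 (𝟙 b) γ (by simp) (by simp)
/-- `{β} : (a --α--> b --βγ--> d) ⟶ (a --αβ--> c --γ--> d)`, the connecting morphism -/
def connecting : K ⟶ C := Adel.mor (𝟙 a) β (𝟙 d) (by simp) (by simp)
/-- `{id_c} : (a --αβ--> c --γ--> d) ⟶ (b --β--> c ⟶ 0)` -/
def C_cokerβ : C ⟶ cokerβ := Adel.mor α (𝟙 c) 0 (by simp) (by simp)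
/-- `{γ} : (b --β--> c ⟶ 0) ⟶ (b --βγ--> d ⟶ 0)` -/
def cokerβ_cokerβγ : cokerβ ⟶ cokerβγ := Adel.mor (𝟙 b) γ (𝟙 _) (by simp) (by simp)

/-- `{id_a} : (0 ⟶ a --αβ--> c) ⟶ (0 ⟶ a ⟶ 0)` -/
def kerαβ_a : kerαβ ⟶ Adel.emb a := Adel.mor (𝟙 _) (𝟙 a) 0 (by simp) (by simp)
/-- `{id_b} : (0 ⟶ b --β--> c) ⟶ (0 ⟶ b ⟶ 0)` -/
def kerβ_b : kerβ ⟶ Adel.emb b := Adel.mor (𝟙 _) (𝟙 b) 0 (by simp) (by simp)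
/-- `{id_b} : (a --α--> b --βγ--> d) ⟶ (a --α--> b ⟶ 0)` -/
def K_cokerα : K ⟶ cokerα := Adel.mor (𝟙 a) (𝟙 b) 0 (by simp) (by simp)

/-- `{α} : (0 ⟶ a ⟶ 0) ⟶ (0 ⟶ b ⟶ 0)` -/
def a_b : Adel.emb a ⟶ Adel.emb b := Adel.mor (𝟙 _) α (𝟙 _) (by simp) (by simp)
/-- `{id_b} : (0 ⟶ b ⟶ 0) ⟶ (a --α--> b ⟶ 0)` -/
def b_cokerα : Adel.emb b ⟶ cokerα := Adel.mor 0 (𝟙 b) (𝟙 _) (by simp) (by simp)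

/-- `{αβ} : (0 ⟶ a ⟶ 0) ⟶ (0 ⟶ c --γ--> d)` -/
def a_kerγ : Adel.emb a ⟶ kerγ :=
  Adel.mor (𝟙 _) (α ≫ β) 0 (by simp) (by simp [comp_eq_zero])
/-- `{β} : (0 ⟶ b ⟶ 0) ⟶ (0 ⟶ c ⟶ 0)` -/
def b_c : Adel.emb b ⟶ Adel.emb c := Adel.mor (𝟙 _) β (𝟙 _) (by simp) (by simp)
/-- `{βγ} : (a --α--> b ⟶ 0) ⟶ (0 ⟶ d ⟶ 0)` -/
def cokerα_d : cokerα ⟶ Adel.emb d :=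
  Adel.mor 0 (β ≫ γ) (𝟙 _) (by simp [comp_eq_zero]) (by simp)

/-- `{id_c} : (0 ⟶ c --γ--> d) ⟶ (0 ⟶ c ⟶ 0)` -/
def kerγ_c : kerγ ⟶ Adel.emb c := Adel.mor (𝟙 _) (𝟙 c) 0 (by simp) (by simp)
/-- `{γ} : (0 ⟶ c ⟶ 0) ⟶ (0 ⟶ d ⟶ 0)` -/
def c_d : Adel.emb c ⟶ Adel.emb d := Adel.mor (𝟙 _) γ (𝟙 _) (by simp) (by simp)

/-- `{id_c} : (0 ⟶ c --γ--> d) ⟶ (a --αβ--> c --γ--> d)` -/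
def kerγ_C : kerγ ⟶ C := Adel.mor 0 (𝟙 c) (𝟙 d) (by simp) (by simp)
/-- `{id_c} : (0 ⟶ c ⟶ 0) ⟶ (b --β--> c ⟶ 0)` -/
def c_cokerβ : Adel.emb c ⟶ cokerβ := Adel.mor 0 (𝟙 c) (𝟙 _) (by simp) (by simp)
/-- `{id_d} : (0 ⟶ d ⟶ 0) ⟶ (b --βγ--> d ⟶ 0)` -/
def d_cokerβγ : Adel.emb d ⟶ cokerβγ := Adel.mor 0 (𝟙 d) (𝟙 _) (by simp) (by simp)

end UniversalSnake

end

open CategoryTheory CategoryTheory.Limits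
open scoped ZeroObject

/-! A morphism of the Adelman category is zero exactly when its datum is null-homotopic, so every
claim reduces to equations between morphisms of the base category. Both composites in each square
have the same datum. For exactness, kernels and cokernels are written down explicitly with
biproducts (`isLimitKernelι`, `isColimitCokernelπ`). A zero composite is exact once its lift to the
kernel is epi and the induced map from the cokernel is mono; no abelian structure is needed.
`epi_mor` and `mono_mor` test these by one-sided inverses up to homotopy, and `exact_of_homotopy`
packs both tests into one self-dual system of equations. At every inner object one of the two
adjacent data is an identity, and this makes the system solvable by identities, zeros and signed
arrows. The relation `α ≫ β ≫ γ = 0` enters only through the existence of the morphisms `a_kerγ` and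
`cokerα_d`. -/

noncomputable section

/-! ### Exactness of short complexes and sequences -/

namespace CategoryTheory.ShortComplex

/-- A short complex is exact if the induced morphism to a kernel of `g` is an epimorphism and the
induced morphism from a cokernel of `f` is a monomorphism. -/
theorem exact_of_epi_lift_of_mono_desc {D : Type*} [Category D] [HasZeroMorphisms D]
    [HasZeroObject D] (S : ShortComplex D)
    {K : D} {i : K ⟶ S.X₂} {wi : i ≫ S.g = 0} (hi : IsLimit (KernelFork.ofι i wi))
    {f' : S.X₁ ⟶ K} (hf' : f' ≫ i = S.f) [Epi f']
    {P : D} {p : S.X₂ ⟶ P} {wp : S.f ≫ p = 0} (hp : IsColimit (CokernelCofork.ofπ p wp))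
    {g' : P ⟶ S.X₃} (hg' : p ≫ g' = S.g) [Mono g'] : S.Exact := by
  have hl : hi.lift (KernelFork.ofι _ S.zero) = f' :=
    Fork.IsLimit.hom_ext hi ((Fork.IsLimit.lift_ι hi).trans hf'.symm)
  have hd : hp.desc (CokernelCofork.ofπ _ S.zero) = g' :=
    Cofork.IsColimit.hom_ext hp ((Cofork.IsColimit.π_desc hp).trans hg'.symm)
  let L : S.LeftHomologyData :=
    { K := K, H := (0 : D), i := i, π := 0, wi := wi, hi := hi
      wπ := comp_zero
      hπ := CokernelCofork.IsColimit.ofEpiOfIsZero _ (by rw [hl]; infer_instance) (isZero_zero D) }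
  let R : S.RightHomologyData :=
    { Q := P, H := (0 : D), p := p, ι := 0, wp := wp, hp := hp
      wι := zero_comp
      hι := KernelFork.IsLimit.ofMonoOfIsZero _ (by rw [hd]; infer_instance) (isZero_zero D) }
  -- Both homologies are zero, so comparing them requires the kernel inclusion followed by the
  -- cokernel projection to vanish.
  have h : i ≫ p = 0 := by
    rw [← cancel_epi f', ← Category.assoc, hf', wp, comp_zero]
  exact ⟨⟨{ left := L, right := R, iso := Iso.refl _, comm := by simp [L, R, h] }, isZero_zero D⟩⟩

end CategoryTheory.ShortComplex

namespace CategoryTheory.ComposableArrows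

variable {D : Type*} [Category D] [HasZeroMorphisms D] {X₀ X₁ X₂ X₃ X₄ X₅ : D}
  {f₁ : X₀ ⟶ X₁} {f₂ : X₁ ⟶ X₂} {f₃ : X₂ ⟶ X₃} {f₄ : X₃ ⟶ X₄} {f₅ : X₄ ⟶ X₅}

theorem exact_mk₃ (h₁ : (mk₂ f₁ f₂).Exact) (h₂ : (mk₂ f₂ f₃).Exact) : (mk₃ f₁ f₂ f₃).Exact :=
  exact_of_δ₀ h₁ h₂

theorem exact_mk₅ (h₁ : (mk₂ f₁ f₂).Exact) (h₂ : (mk₂ f₂ f₃).Exact) (h₃ : (mk₂ f₃ f₄).Exact)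
    (h₄ : (mk₂ f₄ f₅).Exact) : (mk₅ f₁ f₂ f₃ f₄ f₅).Exact :=
  exact_of_δ₀ h₁ (exact_of_δ₀ h₂ (exact_mk₃ h₃ h₄))

end CategoryTheory.ComposableArrows

namespace Adel

/-! ### Calculus of morphism data -/

section Morphisms

variable {A : Type u} [Category.{v} A] [Preadditive A]
variable {r a c r' a' c' r'' a'' c'' : A} {ρ : r ⟶ a} {κ : a ⟶ c} {ρ' : r' ⟶ a'} {κ' : a' ⟶ c'}
  {ρ'' : r'' ⟶ a''} {κ'' : a'' ⟶ c''}

/-- Homotopy is already a congruence, so the quotient identifies nothing beyond homotopic data. -/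
theorem mor_eq_mor_iff {ω₁ ω₂ : r ⟶ r'} {f₁ f₂ : a ⟶ a'} {ψ₁ ψ₂ : c ⟶ c'}
    {hω₁ : ω₁ ≫ ρ' = ρ ≫ f₁} {hψ₁ : κ ≫ ψ₁ = f₁ ≫ κ'}
    {hω₂ : ω₂ ≫ ρ' = ρ ≫ f₂} {hψ₂ : κ ≫ ψ₂ = f₂ ≫ κ'} :
    mor ω₁ f₁ ψ₁ hω₁ hψ₁ = mor ω₂ f₂ ψ₂ hω₂ hψ₂ ↔
      ∃ (σ₁ : a ⟶ r') (σ₂ : c ⟶ a'), f₁ - f₂ = σ₁ ≫ ρ' + κ ≫ σ₂ :=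
  CategoryTheory.Quotient.functor_map_eq_iff _ _ _

theorem mor_congr {ω₁ ω₂ : r ⟶ r'} {f₁ f₂ : a ⟶ a'} {ψ₁ ψ₂ : c ⟶ c'}
    {hω₁ : ω₁ ≫ ρ' = ρ ≫ f₁} {hψ₁ : κ ≫ ψ₁ = f₁ ≫ κ'}
    {hω₂ : ω₂ ≫ ρ' = ρ ≫ f₂} {hψ₂ : κ ≫ ψ₂ = f₂ ≫ κ'} (h : f₁ = f₂) :
    mor ω₁ f₁ ψ₁ hω₁ hψ₁ = mor ω₂ f₂ ψ₂ hω₂ hψ₂ :=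
  mor_eq_mor_iff.2 ⟨0, 0, by simp [h]⟩

theorem mor_comp_mor {ω : r ⟶ r'} {f : a ⟶ a'} {ψ : c ⟶ c'}
    {hω : ω ≫ ρ' = ρ ≫ f} {hψ : κ ≫ ψ = f ≫ κ'}
    {ω' : r' ⟶ r''} {f' : a' ⟶ a''} {ψ' : c' ⟶ c''}
    {hω' : ω' ≫ ρ'' = ρ' ≫ f'} {hψ' : κ' ≫ ψ' = f' ≫ κ''} :
    mor ω f ψ hω hψ ≫ mor ω' f' ψ' hω' hψ' =
      mor (ω ≫ ω') (f ≫ f') (ψ ≫ ψ') (by rw [Category.assoc, hω', reassoc_of% hω])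
        (by rw [reassoc_of% hψ, hψ', Category.assoc]) :=
  rfl

theorem zero_eq_mor :
    (0 : of ρ κ ⟶ of ρ' κ') = mor 0 0 0 (by simp) (by simp) :=
  rfl

theorem mor_eq_zero_iff {ω : r ⟶ r'} {f : a ⟶ a'} {ψ : c ⟶ c'}
    {hω : ω ≫ ρ' = ρ ≫ f} {hψ : κ ≫ ψ = f ≫ κ'} :
    mor ω f ψ hω hψ = 0 ↔ ∃ (σ₁ : a ⟶ r') (σ₂ : c ⟶ a'), f = σ₁ ≫ ρ' + κ ≫ σ₂ := by
  rw [zero_eq_mor, mor_eq_mor_iff, sub_zero]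

theorem mor_comp_mor_eq_mor {ω : r ⟶ r'} {f : a ⟶ a'} {ψ : c ⟶ c'}
    {hω : ω ≫ ρ' = ρ ≫ f} {hψ : κ ≫ ψ = f ≫ κ'}
    {ω' : r' ⟶ r''} {f' : a' ⟶ a''} {ψ' : c' ⟶ c''}
    {hω' : ω' ≫ ρ'' = ρ' ≫ f'} {hψ' : κ' ≫ ψ' = f' ≫ κ''}
    {ω'' : r ⟶ r''} {f'' : a ⟶ a''} {ψ'' : c ⟶ c''}
    {hω'' : ω'' ≫ ρ'' = ρ ≫ f''} {hψ'' : κ ≫ ψ'' = f'' ≫ κ''} (h : f ≫ f' = f'') :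
    mor ω f ψ hω hψ ≫ mor ω' f' ψ' hω' hψ' = mor ω'' f'' ψ'' hω'' hψ'' :=
  mor_comp_mor.trans (mor_congr h)

theorem mor_comp_mor_eq_mor_comp_mor {s b t : A} {μ : s ⟶ b} {ν : b ⟶ t}
    {ω : r ⟶ r'} {f : a ⟶ a'} {ψ : c ⟶ c'} {hω : ω ≫ ρ' = ρ ≫ f} {hψ : κ ≫ ψ = f ≫ κ'}
    {ω' : r' ⟶ r''} {f' : a' ⟶ a''} {ψ' : c' ⟶ c''}
    {hω' : ω' ≫ ρ'' = ρ' ≫ f'} {hψ' : κ' ≫ ψ' = f' ≫ κ''}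
    {θ : r ⟶ s} {g : a ⟶ b} {η : c ⟶ t} {hθ : θ ≫ μ = ρ ≫ g} {hη : κ ≫ η = g ≫ ν}
    {θ' : s ⟶ r''} {g' : b ⟶ a''} {η' : t ⟶ c''}
    {hθ' : θ' ≫ ρ'' = μ ≫ g'} {hη' : ν ≫ η' = g' ≫ κ''} (h : f ≫ f' = g ≫ g') :
    mor ω f ψ hω hψ ≫ mor ω' f' ψ' hω' hψ' = mor θ g η hθ hη ≫ mor θ' g' η' hθ' hη' :=
  mor_comp_mor.trans ((mor_congr h).trans mor_comp_mor.symm)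

theorem mor_comp_mor_eq_zero_iff {ω : r ⟶ r'} {f : a ⟶ a'} {ψ : c ⟶ c'}
    {hω : ω ≫ ρ' = ρ ≫ f} {hψ : κ ≫ ψ = f ≫ κ'}
    {ω' : r' ⟶ r''} {f' : a' ⟶ a''} {ψ' : c' ⟶ c''}
    {hω' : ω' ≫ ρ'' = ρ' ≫ f'} {hψ' : κ' ≫ ψ' = f' ≫ κ''} :
    mor ω f ψ hω hψ ≫ mor ω' f' ψ' hω' hψ' = 0 ↔
      ∃ (σ₁ : a ⟶ r'') (σ₂ : c ⟶ a''), f ≫ f' = σ₁ ≫ ρ'' + κ ≫ σ₂ := by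
  rw [mor_comp_mor, mor_eq_zero_iff]

theorem exists_eq_of (X : Adel A) : ∃ (r a c : A) (ρ : r ⟶ a) (κ : a ⟶ c), X = of ρ κ :=
  ⟨_, _, _, X.as.rel, X.as.corel, rfl⟩

theorem exists_eq_mor (F : of ρ κ ⟶ of ρ' κ') :
    ∃ (ω : r ⟶ r') (f : a ⟶ a') (ψ : c ⟶ c') (hω : ω ≫ ρ' = ρ ≫ f) (hψ : κ ≫ ψ = f ≫ κ'),
      F = mor ω f ψ hω hψ := by
  have hs : Function.Surjective fun h : (⟨ρ, κ⟩ : ComposablePair A) ⟶ ⟨ρ', κ'⟩ =>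
      (CategoryTheory.Quotient.functor ComposablePair.homotopic).map h :=
    Functor.map_surjective _
  obtain ⟨⟨f, ⟨ω, hω⟩, ⟨ψ, hψ⟩⟩, rfl⟩ := hs F
  exact ⟨ω, f, ψ, hω, hψ, rfl⟩

/-- A morphism is an epimorphism if its datum has a right-sided inverse `u`, up to homotopy, where
`u` has a corelation witness. -/
theorem epi_mor {ω : r ⟶ r'} {f : a ⟶ a'} {ψ : c ⟶ c'}
    {hω : ω ≫ ρ' = ρ ≫ f} {hψ : κ ≫ ψ = f ≫ κ'}
    (u : a' ⟶ a) (v : c' ⟶ c) (τ₁ : a' ⟶ r') (τ₂ : c' ⟶ a')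
    (hu : u ≫ κ = κ' ≫ v) (h : 𝟙 a' = u ≫ f + τ₁ ≫ ρ' + κ' ≫ τ₂) :
    Epi (mor ω f ψ hω hψ) := by
  rw [Preadditive.epi_iff_cancel_zero]
  intro Z G hG
  obtain ⟨_, _, _, ρZ, κZ, rfl⟩ := exists_eq_of Z
  obtain ⟨ωg, g, ψg, hωg, hψg, rfl⟩ := exists_eq_mor G
  rw [mor_comp_mor_eq_zero_iff] at hG
  obtain ⟨σ₁, σ₂, hσ⟩ := hG
  -- Expand `g` through the homotopy `h`. The term `u ≫ κ ≫ σ₂` passes through `κ'` by `hu`, and `τ₁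
  -- ≫ ρ' ≫ g` passes through `ρZ` by the relation witness of `g`.
  refine mor_eq_zero_iff.2 ⟨u ≫ σ₁ + τ₁ ≫ ωg, v ≫ σ₂ + τ₂ ≫ g, ?_⟩
  calc g = 𝟙 a' ≫ g := (Category.id_comp g).symm
    _ = _ := by
      rw [h]
      simp only [Preadditive.add_comp, Preadditive.comp_add, Category.assoc, hσ, hωg,
        reassoc_of% hu]
      abel

/-- A morphism is a monomorphism if its datum has a left-sided inverse `u`, up to homotopy, where
`u` has a relation witness. -/
theorem mono_mor {ω : r ⟶ r'} {f : a ⟶ a'} {ψ : c ⟶ c'}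
    {hω : ω ≫ ρ' = ρ ≫ f} {hψ : κ ≫ ψ = f ≫ κ'}
    (u : a' ⟶ a) (v : r' ⟶ r) (τ₁ : a ⟶ r) (τ₂ : c ⟶ a)
    (hu : ρ' ≫ u = v ≫ ρ) (h : 𝟙 a = f ≫ u + τ₁ ≫ ρ + κ ≫ τ₂) :
    Mono (mor ω f ψ hω hψ) := by
  rw [Preadditive.mono_iff_cancel_zero]
  intro Z G hG
  obtain ⟨_, _, _, ρZ, κZ, rfl⟩ := exists_eq_of Z
  obtain ⟨ωg, g, ψg, hωg, hψg, rfl⟩ := exists_eq_mor G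
  rw [mor_comp_mor_eq_zero_iff] at hG
  obtain ⟨σ₁, σ₂, hσ⟩ := hG
  refine mor_eq_zero_iff.2 ⟨σ₁ ≫ v + g ≫ τ₁, σ₂ ≫ u + ψg ≫ τ₂, ?_⟩
  calc g = g ≫ 𝟙 a := (Category.comp_id g).symm
    _ = _ := by
      rw [h]
      simp only [Preadditive.add_comp, Preadditive.comp_add, Category.assoc, reassoc_of% hσ, hu,
        reassoc_of% hψg]
      abel

end Morphisms

/-! ### Explicit kernels and cokernels -/

section Kernels

variable {A : Type u} [Category.{v} A] [Preadditive A] [HasBinaryBiproducts A]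
variable {r a c r' a' c' : A} {ρ : r ⟶ a} {κ : a ⟶ c} {ρ' : r' ⟶ a'} {κ' : a' ⟶ c'}

/-- The corelation of the kernel of a morphism with datum `f`. -/
def kernelCorel (κ : a ⟶ c) (ρ' : r' ⟶ a') (f : a ⟶ a') : a ⊞ r' ⟶ c ⊞ a' :=
  biprod.desc (biprod.lift κ f) (biprod.lift 0 (-ρ'))

/-- The kernel of a morphism with datum `f`. -/
def kernelObj (ρ : r ⟶ a) (κ : a ⟶ c) (ρ' : r' ⟶ a') (f : a ⟶ a') : Adel A :=
  of (biprod.map ρ (𝟙 r')) (kernelCorel κ ρ' f)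

/-- The inclusion of the kernel of a morphism with datum `f`. -/
def kernelι (ρ : r ⟶ a) (κ : a ⟶ c) (ρ' : r' ⟶ a') (f : a ⟶ a') :
    kernelObj ρ κ ρ' f ⟶ of ρ κ :=
  mor biprod.fst biprod.fst biprod.fst (by simp) (by
    apply biprod.hom_ext' <;> simp [kernelCorel])

theorem fst_comp_eq (f : a ⟶ a') :
    biprod.fst ≫ f = biprod.snd ≫ ρ' + kernelCorel κ ρ' f ≫ biprod.snd := by
  apply biprod.hom_ext' <;> simp [kernelCorel]

theorem kernelι_comp {ω : r ⟶ r'} {f : a ⟶ a'} {ψ : c ⟶ c'}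
    (hω : ω ≫ ρ' = ρ ≫ f) (hψ : κ ≫ ψ = f ≫ κ') :
    kernelι ρ κ ρ' f ≫ mor ω f ψ hω hψ = 0 :=
  mor_comp_mor_eq_zero_iff.2 ⟨biprod.snd, biprod.snd, fst_comp_eq f⟩

/-- The identity on `r'` in the relation of the kernel makes the second summand null-homotopic, so
`biprod.inl` inverts the datum up to homotopy. -/
instance mono_kernelι (f : a ⟶ a') : Mono (kernelι ρ κ ρ' f) :=
  mono_mor biprod.inl biprod.inl (biprod.snd ≫ biprod.inr) 0 (by simp) (by
    apply biprod.hom_ext' <;> simp)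

/-- A map into the kernel is a map `h` together with a null-homotopy of `h ≫ f`: `σ₁` extends the
datum, `σ₂` extends the corelation witness, and the corelation of the kernel encodes the homotopy
equation. -/
theorem lift_comp_kernelCorel {t s : A} {κT : t ⟶ s} {h : t ⟶ a} {ψh : s ⟶ c} {f : a ⟶ a'}
    (hψh : κT ≫ ψh = h ≫ κ) {σ₁ : t ⟶ r'} {σ₂ : s ⟶ a'}
    (hσ : h ≫ f = σ₁ ≫ ρ' + κT ≫ σ₂) :
    κT ≫ biprod.lift ψh σ₂ = biprod.lift h σ₁ ≫ kernelCorel κ ρ' f := by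
  apply biprod.hom_ext <;> simp [kernelCorel, hψh, hσ, biprod.lift_desc]

/-- `kernelι` is a kernel. -/
def isLimitKernelι {ω : r ⟶ r'} {f : a ⟶ a'} {ψ : c ⟶ c'}
    (hω : ω ≫ ρ' = ρ ≫ f) (hψ : κ ≫ ψ = f ≫ κ') :
    IsLimit (KernelFork.ofι (kernelι ρ κ ρ' f) (kernelι_comp hω hψ)) :=
  KernelFork.IsLimit.ofι' _ _ fun {T} H hH => by
    -- Representatives and homotopies exist only propositionally, so the lift is obtained by choice;
    -- it is unique because `kernelι` is mono.
    have : ∃ l, l ≫ kernelι ρ κ ρ' f = H := by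
      obtain ⟨_, _, _, ρT, κT, rfl⟩ := exists_eq_of T
      obtain ⟨ωh, h, ψh, hωh, hψh, rfl⟩ := exists_eq_mor H
      rw [mor_comp_mor_eq_zero_iff] at hH
      obtain ⟨σ₁, σ₂, hσ⟩ := hH
      exact ⟨mor (biprod.lift ωh (ρT ≫ σ₁)) (biprod.lift h σ₁) (biprod.lift ψh σ₂)
        (by apply biprod.hom_ext <;> simp [hωh]) (lift_comp_kernelCorel hψh hσ),
        mor_comp_mor_eq_mor (biprod.lift_fst _ _)⟩
    exact ⟨this.choose, this.choose_spec⟩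

/-- The relation of the cokernel of a morphism with datum `f`. -/
def cokernelRel (κ : a ⟶ c) (ρ' : r' ⟶ a') (f : a ⟶ a') : r' ⊞ a ⟶ a' ⊞ c :=
  biprod.desc (biprod.lift ρ' 0) (biprod.lift f (-κ))

/-- The cokernel of a morphism with datum `f`. -/
def cokernelObj (κ : a ⟶ c) (ρ' : r' ⟶ a') (κ' : a' ⟶ c') (f : a ⟶ a') : Adel A :=
  of (cokernelRel κ ρ' f) (biprod.map κ' (𝟙 c))

/-- The projection to the cokernel of a morphism with datum `f`. -/
def cokernelπ (κ : a ⟶ c) (ρ' : r' ⟶ a') (κ' : a' ⟶ c') (f : a ⟶ a') :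
    of ρ' κ' ⟶ cokernelObj κ ρ' κ' f :=
  mor biprod.inl biprod.inl biprod.inl (by
    apply biprod.hom_ext <;> simp [cokernelRel]) (by simp)

theorem comp_inl_eq (f : a ⟶ a') :
    f ≫ biprod.inl = biprod.inr ≫ cokernelRel κ ρ' f + κ ≫ biprod.inr := by
  apply biprod.hom_ext <;> simp [cokernelRel]

theorem comp_cokernelπ {ω : r ⟶ r'} {f : a ⟶ a'} {ψ : c ⟶ c'}
    (hω : ω ≫ ρ' = ρ ≫ f) (hψ : κ ≫ ψ = f ≫ κ') :
    mor ω f ψ hω hψ ≫ cokernelπ κ ρ' κ' f = 0 :=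
  mor_comp_mor_eq_zero_iff.2 ⟨biprod.inr, biprod.inr, comp_inl_eq f⟩

instance epi_cokernelπ (f : a ⟶ a') : Epi (cokernelπ κ ρ' κ' f) :=
  epi_mor biprod.fst biprod.fst 0 (biprod.snd ≫ biprod.inr) (by simp) (by
    apply biprod.hom_ext' <;> simp)

/-- Dually, a map out of the cokernel is a map `h` with a null-homotopy of `f ≫ h`; here `σ₁`
extends the relation witness and `σ₂` the datum. -/
theorem cokernelRel_comp_desc {s t : A} {ρT : s ⟶ t} {h : a' ⟶ t} {ωh : r' ⟶ s} {f : a ⟶ a'}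
    (hωh : ωh ≫ ρT = ρ' ≫ h) {σ₁ : a ⟶ s} {σ₂ : c ⟶ t}
    (hσ : f ≫ h = σ₁ ≫ ρT + κ ≫ σ₂) :
    biprod.desc ωh σ₁ ≫ ρT = cokernelRel κ ρ' f ≫ biprod.desc h σ₂ := by
  apply biprod.hom_ext' <;> simp [cokernelRel, hωh, hσ, biprod.lift_desc]

/-- `cokernelπ` is a cokernel. -/
def isColimitCokernelπ {ω : r ⟶ r'} {f : a ⟶ a'} {ψ : c ⟶ c'}
    (hω : ω ≫ ρ' = ρ ≫ f) (hψ : κ ≫ ψ = f ≫ κ') :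
    IsColimit (CokernelCofork.ofπ (cokernelπ κ ρ' κ' f) (comp_cokernelπ hω hψ)) :=
  CokernelCofork.IsColimit.ofπ' _ _ fun {T} H hH => by
    have : ∃ l, cokernelπ κ ρ' κ' f ≫ l = H := by
      obtain ⟨_, _, _, ρT, κT, rfl⟩ := exists_eq_of T
      obtain ⟨ωh, h, ψh, hωh, hψh, rfl⟩ := exists_eq_mor H
      rw [mor_comp_mor_eq_zero_iff] at hH
      obtain ⟨σ₁, σ₂, hσ⟩ := hH
      exact ⟨mor (biprod.desc ωh σ₁) (biprod.desc h σ₂) (biprod.desc ψh (σ₂ ≫ κT))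
        (cokernelRel_comp_desc hωh hσ) (by apply biprod.hom_ext' <;> simp [hψh]),
        mor_comp_mor_eq_mor (biprod.inl_desc _ _)⟩
    exact ⟨this.choose, this.choose_spec⟩

end Kernels

/-! ### The equational criterion for exactness -/

section Exactness

variable {A : Type u} [Category.{v} A] [Preadditive A] [HasBinaryBiproducts A] [HasZeroObject A]
variable {r a c r' a' c' r'' a'' c'' : A} {ρ : r ⟶ a} {κ : a ⟶ c} {ρ' : r' ⟶ a'} {κ' : a' ⟶ c'}
  {ρ'' : r'' ⟶ a''} {κ'' : a'' ⟶ c''}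

instance hasZeroObject : HasZeroObject (Adel A) := ⟨⟨zero, zero_isZero⟩⟩

/-- A criterion for exactness in the Adelman category, in terms of equations in `A`. -/
theorem exact_of_homotopy {ω : r ⟶ r'} {f : a ⟶ a'} {ψ : c ⟶ c'}
    {hω : ω ≫ ρ' = ρ ≫ f} {hψ : κ ≫ ψ = f ≫ κ'}
    {ω' : r' ⟶ r''} {g : a' ⟶ a''} {ψ' : c' ⟶ c''}
    {hω' : ω' ≫ ρ'' = ρ' ≫ g} {hψ' : κ' ≫ ψ' = g ≫ κ''}
    (σ₁ : a ⟶ r'') (σ₂ : c ⟶ a'')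
    (u : a' ⟶ a) (t : a'' ⟶ a') (p : a' ⟶ r') (q : c' ⟶ a')
    (u' : r'' ⟶ a) (p' : r'' ⟶ r') (v : c' ⟶ c) (v' : a'' ⟶ c)
    (hσ : f ≫ g = σ₁ ≫ ρ'' + κ ≫ σ₂)
    (h₁ : 𝟙 a' = u ≫ f + p ≫ ρ' + κ' ≫ q + g ≫ t)
    (h₂ : ρ'' ≫ t = u' ≫ f + p' ≫ ρ')
    (h₃ : u ≫ κ = κ' ≫ v + g ≫ v')
    (h₄ : u' ≫ κ = -(ρ'' ≫ v')) :
    (ComposableArrows.mk₂ (mor ω f ψ hω hψ) (mor ω' g ψ' hω' hψ')).Exact := by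
  have w : mor ω f ψ hω hψ ≫ mor ω' g ψ' hω' hψ' = 0 :=
    mor_comp_mor_eq_zero_iff.2 ⟨σ₁, σ₂, hσ⟩
  let F' : of ρ κ ⟶ kernelObj ρ' κ' ρ'' g :=
    mor (biprod.lift ω (ρ ≫ σ₁)) (biprod.lift f σ₁) (biprod.lift ψ σ₂)
      (by apply biprod.hom_ext <;> simp [hω]) (lift_comp_kernelCorel hψ hσ)
  let G' : cokernelObj κ ρ' κ' f ⟶ of ρ'' κ'' :=
    mor (biprod.desc ω' σ₁) (biprod.desc g σ₂) (biprod.desc ψ' (σ₂ ≫ κ''))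
      (cokernelRel_comp_desc hω' hσ) (by apply biprod.hom_ext' <;> simp [hψ'])
  have : Epi F' := by
    -- `h₃` and `h₄` give the corelation witness; `h₁` and `h₂` are the components of the homotopy
    -- into `a'`. Those into `r''` hold by the choice of the terms in `σ₁`, as the relation of the
    -- kernel is the identity there.
    refine epi_mor (biprod.desc u u') (biprod.desc v v')
      (biprod.desc (biprod.lift p (-(u ≫ σ₁))) (biprod.lift p' (𝟙 _ - u' ≫ σ₁)))
      (biprod.desc (biprod.lift q 0) (biprod.lift t 0)) ?_ ?_
    · apply biprod.hom_ext' <;> simp [kernelCorel, biprod.lift_desc, h₃, h₄]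
    · apply biprod.hom_ext' <;> apply biprod.hom_ext <;>
        simp [kernelCorel, biprod.lift_desc, h₁, h₂]
      abel
  have : Mono G' := by
    -- Dual roles: `h₂` and `h₄` give the relation witness, `h₁` and `h₃` the homotopy.
    refine mono_mor (biprod.lift t v') (biprod.lift p' u')
      (biprod.desc (biprod.lift p u) 0)
      (biprod.desc (biprod.lift q v) (biprod.lift (-(σ₂ ≫ t)) (𝟙 _ - σ₂ ≫ v'))) ?_ ?_
    · apply biprod.hom_ext <;> simp [cokernelRel, biprod.lift_desc, h₂, h₄, add_comm]
    · apply biprod.hom_ext' <;> apply biprod.hom_ext <;>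
        simp [cokernelRel, biprod.lift_desc, h₁, h₃]
      abel
  have hF : F' ≫ kernelι ρ' κ' ρ'' g = mor ω f ψ hω hψ :=
    mor_comp_mor_eq_mor (biprod.lift_fst _ _)
  have hG : cokernelπ κ ρ' κ' f ≫ G' = mor ω' g ψ' hω' hψ' :=
    mor_comp_mor_eq_mor (biprod.inl_desc _ _)
  exact ComposableArrows.exact₂_mk _ w
    (ShortComplex.exact_of_epi_lift_of_mono_desc (ShortComplex.mk _ _ w)
      (isLimitKernelι hω' hψ') hF
      (isColimitCokernelπ hω hψ) hG)

/-- The datum `g` is inverted by `t`, which needs only a relation witness, as in `mono_mor`. -/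
theorem exact_zero_mor {ω' : r' ⟶ r''} {g : a' ⟶ a''} {ψ' : c' ⟶ c''}
    {hω' : ω' ≫ ρ'' = ρ' ≫ g} {hψ' : κ' ≫ ψ' = g ≫ κ''}
    (t : a'' ⟶ a') (p' : r'' ⟶ r') (h₁ : 𝟙 a' = g ≫ t) (h₂ : ρ'' ≫ t = p' ≫ ρ') :
    (ComposableArrows.mk₂ (0 : zero ⟶ of ρ' κ') (mor ω' g ψ' hω' hψ')).Exact :=
  exact_of_homotopy (ρ := (0 : (0 : A) ⟶ 0)) (κ := (0 : (0 : A) ⟶ 0)) (ω := 0) (f := 0) (ψ := 0)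
    (hω := by simp) (hψ := by simp) 0 0 0 t 0 0 0 p' 0 0 (by simp) (by simpa) (by simpa)
    (by simp) (by simp)

theorem exact_mor_zero {ω : r ⟶ r'} {f : a ⟶ a'} {ψ : c ⟶ c'}
    {hω : ω ≫ ρ' = ρ ≫ f} {hψ : κ ≫ ψ = f ≫ κ'}
    (u : a' ⟶ a) (v : c' ⟶ c) (h₁ : 𝟙 a' = u ≫ f) (h₃ : u ≫ κ = κ' ≫ v) :
    (ComposableArrows.mk₂ (mor ω f ψ hω hψ) (0 : of ρ' κ' ⟶ zero)).Exact :=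
  exact_of_homotopy (ρ'' := (0 : (0 : A) ⟶ 0)) (κ'' := (0 : (0 : A) ⟶ 0)) (ω' := 0) (g := 0)
    (ψ' := 0) (hω' := by simp) (hψ' := by simp) 0 0 u 0 0 0 0 0 v 0 (by simp) (by simpa) (by simp)
    (by simpa) (by simp)

end Exactness

end Adel

/-! ### Exactness in the universal snake diagram -/

namespace UniversalSnake

instance hasBinaryBiproducts : HasBinaryBiproducts BaseCat :=
  hasBinaryBiproducts_of_finite_biproducts _

/-- The outgoing datum is an identity, inverted by `t`, and the incoming datum is the relation of
the target, so `u'` and `σ₁` are identities. -/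
theorem exact_a_b_cokerα : (ComposableArrows.mk₂ a_b b_cokerα).Exact :=
  Adel.exact_of_homotopy (𝟙 a) 0 0 (𝟙 b) 0 0 (𝟙 a) 0 0 0
    (by simp) (by simp) (by simp) (by simp) (by simp)

/-- The incoming datum is an identity, inverted by `u`, and the outgoing datum is the corelation of
the source, so `v'` and `σ₂` are identities. -/
theorem exact_kerγ_c_d : (ComposableArrows.mk₂ kerγ_c c_d).Exact :=
  Adel.exact_of_homotopy 0 (𝟙 d) (𝟙 c) 0 0 0 0 0 0 (𝟙 d)
    (by simp) (by simp) (by simp) (by simp) (by simp)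

theorem exact_kerαβ_a_kerγ : (ComposableArrows.mk₂ kerαβ_a a_kerγ).Exact :=
  Adel.exact_of_homotopy 0 (𝟙 c) (𝟙 a) 0 0 0 0 0 0 (𝟙 c)
    (by simp) (by simp) (by simp) (by simp) (by simp)

theorem exact_a_kerγ_C : (ComposableArrows.mk₂ a_kerγ kerγ_C).Exact :=
  Adel.exact_of_homotopy (𝟙 a) 0 0 (𝟙 c) 0 0 (𝟙 a) 0 0 0
    (by simp) (by simp) (by simp) (by simp) (by simp)

theorem exact_kerβ_b_c : (ComposableArrows.mk₂ kerβ_b b_c).Exact :=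
  Adel.exact_of_homotopy 0 (𝟙 c) (𝟙 b) 0 0 0 0 0 0 (𝟙 c)
    (by simp) (by simp) (by simp) (by simp) (by simp)

theorem exact_b_c_cokerβ : (ComposableArrows.mk₂ b_c c_cokerβ).Exact :=
  Adel.exact_of_homotopy (𝟙 b) 0 0 (𝟙 c) 0 0 (𝟙 b) 0 0 0
    (by simp) (by simp) (by simp) (by simp) (by simp)

theorem exact_K_cokerα_d : (ComposableArrows.mk₂ K_cokerα cokerα_d).Exact :=
  Adel.exact_of_homotopy 0 (𝟙 d) (𝟙 b) 0 0 0 0 0 0 (𝟙 d)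
    (by simp) (by simp) (by simp) (by simp) (by simp)

theorem exact_cokerα_d_cokerβγ : (ComposableArrows.mk₂ cokerα_d d_cokerβγ).Exact :=
  Adel.exact_of_homotopy (𝟙 b) 0 0 (𝟙 d) 0 0 (𝟙 b) 0 0 0
    (by simp) (by simp) (by simp) (by simp) (by simp)

/-- The source now has corelation `α ≫ β`, so `u' = 𝟙 a` forces a correction: `v' = -β` balances the
last equation, and `v = 𝟙 c` then cancels it in the preceding one. -/
theorem exact_kerαβ_kerβ_K : (ComposableArrows.mk₂ kerαβ_kerβ kerβ_K).Exact :=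
  Adel.exact_of_homotopy (𝟙 a) 0 0 (𝟙 b) 0 0 (𝟙 a) 0 (𝟙 c) (-β)
    (by simp) (by simp) (by simp) (by simp) (by simp)

/-- Dual correction: `v' = 𝟙 c` forces `u' = -α` because the target has relation `α ≫ β`, and `p' =
𝟙 a` cancels it against the relation `α` of `K`. -/
theorem exact_kerβ_K_C : (ComposableArrows.mk₂ kerβ_K connecting).Exact :=
  Adel.exact_of_homotopy 0 (𝟙 c) (𝟙 b) 0 0 0 (-α) (𝟙 a) 0 (𝟙 c)
    (by simp) (by simp) (by simp) (by simp) (by simp)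

theorem exact_K_C_cokerβ : (ComposableArrows.mk₂ connecting C_cokerβ).Exact :=
  Adel.exact_of_homotopy (𝟙 b) 0 0 (𝟙 c) 0 0 (𝟙 b) 0 (𝟙 d) (-γ)
    (by simp) (by simp) (by simp) (by simp) (by simp)

theorem exact_C_cokerβ_cokerβγ : (ComposableArrows.mk₂ C_cokerβ cokerβ_cokerβγ).Exact :=
  Adel.exact_of_homotopy 0 (𝟙 d) (𝟙 c) 0 0 0 (-β) (𝟙 b) 0 (𝟙 d)
    (by simp) (by simp) (by simp) (by simp) (by simp)

theorem exact_zero_kerγ_c : (ComposableArrows.mk₂ (0 : Adel.zero ⟶ kerγ) kerγ_c).Exact :=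
  Adel.exact_zero_mor (𝟙 _) 0 (by simp) (by simp)

theorem exact_zero_kerαβ_a : (ComposableArrows.mk₂ (0 : Adel.zero ⟶ kerαβ) kerαβ_a).Exact :=
  Adel.exact_zero_mor (𝟙 _) 0 (by simp) (by simp)

theorem exact_zero_kerβ_b : (ComposableArrows.mk₂ (0 : Adel.zero ⟶ kerβ) kerβ_b).Exact :=
  Adel.exact_zero_mor (𝟙 _) 0 (by simp) (by simp)

theorem exact_zero_K_cokerα : (ComposableArrows.mk₂ (0 : Adel.zero ⟶ K) K_cokerα).Exact :=
  Adel.exact_zero_mor (𝟙 _) (𝟙 a) (by simp) (by simp)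

theorem exact_b_cokerα_zero : (ComposableArrows.mk₂ b_cokerα (0 : cokerα ⟶ Adel.zero)).Exact :=
  Adel.exact_mor_zero (𝟙 _) 0 (by simp) (by simp)

theorem exact_kerγ_C_zero : (ComposableArrows.mk₂ kerγ_C (0 : C ⟶ Adel.zero)).Exact :=
  Adel.exact_mor_zero (𝟙 _) (𝟙 d) (by simp) (by simp)

theorem exact_c_cokerβ_zero : (ComposableArrows.mk₂ c_cokerβ (0 : cokerβ ⟶ Adel.zero)).Exact :=
  Adel.exact_mor_zero (𝟙 _) 0 (by simp) (by simp)

theorem exact_d_cokerβγ_zero : (ComposableArrows.mk₂ d_cokerβγ (0 : cokerβγ ⟶ Adel.zero)).Exact :=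
  Adel.exact_mor_zero (𝟙 _) 0 (by simp) (by simp)

end UniversalSnake

end

open UniversalSnake in
theorem mainTheorem3 :
    -- the diagram commutes
    (CommSq kerαβ_kerβ kerαβ_a kerβ_b a_b ∧
      CommSq kerβ_K kerβ_b K_cokerα b_cokerα ∧
      CommSq a_b a_kerγ b_c kerγ_c ∧
      CommSq b_cokerα b_c cokerα_d c_d ∧
      CommSq kerγ_c kerγ_C c_cokerβ C_cokerβ ∧
      CommSq c_d c_cokerβ d_cokerβγ cokerβ_cokerβγ) ∧
    -- the rows are exact
    (ComposableArrows.mk₃ a_b b_cokerα (0 : cokerα ⟶ Adel.zero)).Exact ∧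
    (ComposableArrows.mk₃ (0 : Adel.zero ⟶ kerγ) kerγ_c c_d).Exact ∧
    -- the columns are exact
    (ComposableArrows.mk₅ (0 : Adel.zero ⟶ kerαβ) kerαβ_a a_kerγ kerγ_C
      (0 : C ⟶ Adel.zero)).Exact ∧
    (ComposableArrows.mk₅ (0 : Adel.zero ⟶ kerβ) kerβ_b b_c c_cokerβ
      (0 : cokerβ ⟶ Adel.zero)).Exact ∧
    (ComposableArrows.mk₅ (0 : Adel.zero ⟶ K) K_cokerα cokerα_d d_cokerβγ
      (0 : cokerβγ ⟶ Adel.zero)).Exact ∧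
    -- the snake is exact
    (ComposableArrows.mk₅ kerαβ_kerβ kerβ_K connecting C_cokerβ cokerβ_cokerβγ).Exact := by
  refine ⟨⟨⟨?_⟩, ⟨?_⟩, ⟨?_⟩, ⟨?_⟩, ⟨?_⟩, ⟨?_⟩⟩,
    ComposableArrows.exact_mk₃ exact_a_b_cokerα exact_b_cokerα_zero,
    ComposableArrows.exact_mk₃ exact_zero_kerγ_c exact_kerγ_c_d,
    ComposableArrows.exact_mk₅ exact_zero_kerαβ_a exact_kerαβ_a_kerγ exact_a_kerγ_C
      exact_kerγ_C_zero,
    ComposableArrows.exact_mk₅ exact_zero_kerβ_b exact_kerβ_b_c exact_b_c_cokerβ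
      exact_c_cokerβ_zero,
    ComposableArrows.exact_mk₅ exact_zero_K_cokerα exact_K_cokerα_d exact_cokerα_d_cokerβγ
      exact_d_cokerβγ_zero,
    ComposableArrows.exact_mk₅ exact_kerαβ_kerβ_K exact_kerβ_K_C exact_K_C_cokerβ
      exact_C_cokerβ_cokerβγ⟩
  all_goals exact Adel.mor_comp_mor_eq_mor_comp_mor (by simp)
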